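/- Let $V$ be a finite set of $n$ elements. A weighted graph $G$ on $V$ consists of real numbers $r_i$ ($i\in V$) and symmetric real edge weights $\lambda_{jk}=\lambda_{kj}\le 0$ ($j\ne k$ in $V$); two distinct vertices $j,k$ are neighbors if $\lambda_{jk}\neq 0$. For $U\subseteq V$, the weighted matching polynomial of the subgraph of $G$ induced on $U$ is \[\mu(G[U])(x)=\sum_{M}\ \prod_{i\in U,\ i\notin M}(x-r_i)\prod_{jk\in M}\lambda_{jk},\] where $M$ runs over all sets of pairwise disjoint two-element subsets of $U$ and $i\notin M$ means that $i$ is not covered by $M$; thus $\mu(\emptyset)=1$. Write $\mu(G)=\mu(G[V])$ and $\mu(G\setminus S)=\mu(G[V\setminus S])$. Let $c: i_1\to i_n$ be a Hamiltonian path $i_1,i_2,\dots,i_n$ in $G$ and let $-c: i_n\to i_1$ be the reversed path. For a real number $\theta$ let $V_c(\theta)$ be the number of indices $k\in\{1,\dots,n\}$ for which the value at $\theta$ of the rational function \[\frac{\mu(G\setminus i_1,\dots,i_{k-1})}{\mu(G\setminus i_1,\dots,i_{k})}\] is positive, and let $V_{-c}(\theta)$ be the analogous number for $-c$. **Theorem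 (Sylvester theorem).** (a) For every real $\theta$ at which none of the $n$ rational functions for $c$ has a pole, $V_c(\theta)$ is equal to the number of zeros of $\mu(G)$ in $(-\infty,\theta)$. (b) For every real $\theta$ at which none of the $n$ rational functions for $-c$ has a pole, $V_{-c}(\theta)$ is equal to the number of zeros of $\mu(G)$ in $(-\infty,\theta)$. (c) All zeros of $\mu(G)$ are real and distinct. -/

import Mathlib

open Polynomial

/-- A weighted graph on `V`: the complete graph on `V` with vertex weights `x - r i` and non-positive
edge weights `lam s(j, k)` for `j ≠ k`. Edges of weight zero are considered non-existent.
(The value of `lam` at a diagonal element `s(i, i)` is never used.) -/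
structure WeightedGraph (V : Type*) where
  r : V → ℝ
  lam : Sym2 V → ℝ
  lam_nonpos : ∀ e : Sym2 V, ¬ e.IsDiag → lam e ≤ 0

namespace WeightedGraph

variable {V : Type*}

/-- The underlying simple graph: distinct `j`, `k` are neighbors if `lam s(j, k) ≠ 0`. -/
def graph (G : WeightedGraph V) : SimpleGraph V where
  Adj j k := j ≠ k ∧ G.lam s(j, k) ≠ 0
  symm := ⟨fun j k h => ⟨h.1.symm, by rw [Sym2.eq_swap]; exact h.2⟩⟩
  loopless := ⟨fun _ h => h.1 rfl⟩

open Classical in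
/-- The matchings of the complete graph on the vertex set `U`: sets of edges between distinct
vertices of `U`, no two of which have a vertex in common. -/
noncomputable def matchings (U : Finset V) : Finset (Finset (Sym2 V)) :=
  {M ∈ ({e ∈ U.sym2 | ¬ e.IsDiag} : Finset (Sym2 V)).powerset |
    ∀ e ∈ M, ∀ f ∈ M, e ≠ f → ∀ v, v ∈ e → v ∉ f}

open Classical in
/-- The weighted matching polynomial of the subgraph of `G` induced on the vertex set `U`. -/
noncomputable def mu (G : WeightedGraph V) (U : Finset V) : ℝ[X] :=
  ∑ M ∈ matchings U,
    (∏ i ∈ U with ∀ e ∈ M, i ∉ e, (X - C (G.r i))) * ∏ e ∈ M, C (G.lam e)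

/-- For a list `l = [i₁, …, iₙ]` of vertices and `k < n`, the rational function
`μ(G ∖ i₁, …, iₖ) / μ(G ∖ i₁, …, iₖ₊₁)`. -/
noncomputable def ratio [Fintype V] [DecidableEq V] (G : WeightedGraph V) (l : List V) (k : ℕ) :
    RatFunc ℝ :=
  algebraMap ℝ[X] (RatFunc ℝ) (G.mu (Finset.univ \ (l.take k).toFinset)) /
    algebraMap ℝ[X] (RatFunc ℝ) (G.mu (Finset.univ \ (l.take (k + 1)).toFinset))

/-- None of the ratios along the list `l` is infinite (has a pole) at `θ`. -/
def FiniteAlong [Fintype V] [DecidableEq V] (G : WeightedGraph V) (l : List V) (θ : ℝ) : Prop :=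
  ∀ k < l.length, (G.ratio l k).denom.eval θ ≠ 0

open Classical in
/-- The number of indices at which the ratio along `l` takes a positive value at `θ`. -/
noncomputable def numPos [Fintype V] [DecidableEq V] (G : WeightedGraph V) (l : List V) (θ : ℝ) :
    ℕ :=
  Finset.card {k ∈ Finset.range l.length | 0 < (G.ratio l k).eval (RingHom.id ℝ) θ}

end WeightedGraph

/-!
For a vertex `i` outside `U`, sorting the matchings of `U ∪ {i}` by the edge at `i` gives
`μ(U ∪ {i}) = (x - rᵢ) μ(U) + ∑ j ∈ U, λᵢⱼ μ(U ∖ j)` (`WeightedGraph.mu_insert`). Dividing by `μ(U)`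
exhibits `αᵢ(U) = μ(U ∪ {i}) / μ(U)` as `x - rᵢ - ∑ j ∈ U, (-λᵢⱼ) / αⱼ(U ∖ j)`, a continued fraction
whose derivative is `1 + ∑ j ∈ U, (-λᵢⱼ) αⱼ(U ∖ j)' / αⱼ(U ∖ j)²`. Free of denominators, this is an
identity for Wronskians (`WeightedGraph.wronskian_mu_insert`): the Wronskian of `μ(U)` and
`μ(U ∪ {i})` is `μ(U)²` plus a combination, with the nonnegative coefficients `-λᵢⱼ`, of Wronskians
for smaller vertex sets. So all these Wronskians are nonnegative on the real line, and if `U ∪ {i}`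
is traversed by a path starting at `i`, then following the first edge of the path at each stage
shows that the Wronskian is everywhere positive (`WeightedGraph.wronskian_mu_pos_of_isChain`).

A positive Wronskian of `f` and `g` means that `f` and `g` have no common root, that the roots of
`g` are simple, and that `g / f` increases strictly between its poles. If moreover `f` and `g` are monic
and `deg g = deg f + 1`, then `g / f` comes from `-∞` at `-∞`, so that zeros and poles alternate,
beginning with a zero. Hence below a point `t` that is not a pole, `g` has one more root than `f` if
`g / f` is positive at `t`, and equally many otherwise (`Polynomial.card_rootsBelow_eq`). Summing
this over the vertices of a Hamiltonian path gives the count of the roots below `t`. Taking `t` large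
shows that `g` splits over the reals if `f` does so with simple roots
(`Polynomial.splits_of_wronskian_pos`), so the roots of `μ(G)` are real.
-/

/-! ### Recurrence for the matching polynomial -/

namespace WeightedGraph

variable {V : Type*}

theorem mem_matchings {U : Finset V} {M : Finset (Sym2 V)} :
    M ∈ matchings U ↔ (∀ e ∈ M, (∀ v ∈ e, v ∈ U) ∧ ¬ e.IsDiag) ∧
      ∀ e ∈ M, ∀ f ∈ M, e ≠ f → ∀ v, v ∈ e → v ∉ f := by
  classical
  simp only [matchings, Finset.mem_filter, Finset.mem_powerset, Finset.subset_iff,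
    Finset.mem_sym2_iff]

variable (G : WeightedGraph V)

@[simp]
theorem mu_empty : G.mu ∅ = 1 := by
  classical
  have h : matchings (∅ : Finset V) = {∅} := by
    ext M
    rw [mem_matchings, Finset.mem_singleton]
    refine ⟨fun h => Finset.eq_empty_of_forall_notMem fun e he => ?_, by rintro rfl; simp⟩
    induction e with
    | _ a b => simpa using (h.1 _ he).1 a (Sym2.mem_mk_left a b)
  simp [mu, h]

theorem neg_lam_nonneg {U : Finset V} {i j : V} (hi : i ∉ U) (hj : j ∈ U) :
    0 ≤ -G.lam s(i, j) :=
  neg_nonneg.2 (G.lam_nonpos _ fun h => hi (Sym2.mk_isDiag_iff.1 h ▸ hj))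

variable [DecidableEq V]

theorem mem_matchings_insert_uncovered {U : Finset V} {i : V} (hi : i ∉ U)
    {M : Finset (Sym2 V)} :
    (M ∈ matchings (insert i U) ∧ ∀ e ∈ M, i ∉ e) ↔ M ∈ matchings U := by
  simp only [mem_matchings]
  constructor
  · rintro ⟨⟨h1, h2⟩, h3⟩
    refine ⟨fun e he => ⟨fun v hv => ?_, (h1 e he).2⟩, h2⟩
    rcases Finset.mem_insert.1 ((h1 e he).1 v hv) with rfl | h
    · exact absurd hv (h3 e he)
    · exact h
  · rintro ⟨h1, h2⟩
    exact ⟨⟨fun e he => ⟨fun v hv => Finset.mem_insert_of_mem ((h1 e he).1 v hv), (h1 e he).2⟩,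
      h2⟩, fun e he hie => hi ((h1 e he).1 i hie)⟩

theorem insert_mem_matchings {U : Finset V} {i j : V} (hi : i ∉ U) (hj : j ∈ U)
    {M : Finset (Sym2 V)} (hM : M ∈ matchings (U.erase j)) :
    insert s(i, j) M ∈ matchings (insert i U) := by
  rw [mem_matchings] at hM ⊢
  obtain ⟨h1, h2⟩ := hM
  have hij : i ≠ j := fun h => hi (h ▸ hj)
  have hd : ∀ e ∈ M, ∀ v, v ∈ s(i, j) → v ∉ e := by
    intro e he v hv hve
    have hvU := (h1 e he).1 v hve
    rcases Sym2.mem_iff.1 hv with rfl | rfl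
    · exact hi (Finset.mem_of_mem_erase hvU)
    · exact Finset.notMem_erase _ _ hvU
  refine ⟨fun e he => ?_, fun e he f hf hef v hve => ?_⟩
  · rcases Finset.mem_insert.1 he with rfl | he
    · refine ⟨fun v hv => ?_, by simpa using hij⟩
      rcases Sym2.mem_iff.1 hv with rfl | rfl <;> simp [hj]
    · exact ⟨fun v hv => Finset.mem_insert_of_mem (Finset.mem_of_mem_erase ((h1 e he).1 v hv)),
        (h1 e he).2⟩
  · rcases Finset.mem_insert.1 he with rfl | he <;> rcases Finset.mem_insert.1 hf with rfl | hf
    · exact absurd rfl hef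
    · exact hd f hf v hve
    · exact fun hv => hd e he v hv hve
    · exact h2 e he f hf hef v hve

theorem erase_mem_matchings {U : Finset V} {i j : V} {M : Finset (Sym2 V)}
    (hM : M ∈ matchings (insert i U)) (hij : s(i, j) ∈ M) :
    M.erase s(i, j) ∈ matchings (U.erase j) := by
  rw [mem_matchings] at hM ⊢
  obtain ⟨h1, h2⟩ := hM
  refine ⟨fun e he => ⟨fun v hv => ?_, (h1 e (Finset.mem_of_mem_erase he)).2⟩,
    fun e he f hf => h2 e (Finset.mem_of_mem_erase he) f (Finset.mem_of_mem_erase hf)⟩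
  have hne := Finset.ne_of_mem_erase he
  have hve := h2 e (Finset.mem_of_mem_erase he) _ hij hne v hv
  simp only [Sym2.mem_iff, not_or] at hve
  exact Finset.mem_erase.2 ⟨hve.2, Finset.mem_of_mem_insert_of_ne
    ((h1 e (Finset.mem_of_mem_erase he)).1 v hv) hve.1⟩

/-- A matching of `insert i U` either leaves `i` uncovered, or consists of an edge `s(i, j)` and
a matching of `U.erase j`. -/
theorem sum_matchings_insert {β : Type*} [AddCommMonoid β] {U : Finset V} {i : V} (hi : i ∉ U)
    (f : Finset (Sym2 V) → β) :
    ∑ M ∈ matchings (insert i U), f M =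
      ∑ M ∈ matchings U, f M +
        ∑ j ∈ U, ∑ M ∈ matchings (U.erase j), f (insert s(i, j) M) := by
  classical
  rw [← Finset.sum_filter_add_sum_filter_not (matchings (insert i U)) (fun M => ∀ e ∈ M, i ∉ e)]
  congr 1
  · refine Finset.sum_congr (Finset.ext fun M => ?_) fun _ _ => rfl
    rw [Finset.mem_filter, mem_matchings_insert_uncovered hi]
  · rw [Finset.sum_sigma']
    symm
    have hnot : ∀ j, ∀ M ∈ matchings (U.erase j), s(i, j) ∉ M := fun j M hM h =>
      Finset.notMem_erase j U (((mem_matchings.1 hM).1 _ h).1 j (Sym2.mem_mk_right i j))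
    refine Finset.sum_bij (fun p _ => insert s(i, p.1) p.2) ?_ ?_ ?_ fun _ _ => rfl
    · rintro ⟨j, M⟩ h
      obtain ⟨hj, hM⟩ := Finset.mem_sigma.1 h
      refine Finset.mem_filter.2 ⟨insert_mem_matchings hi hj hM, fun h => ?_⟩
      exact h _ (Finset.mem_insert_self _ _) (Sym2.mem_mk_left i j)
    · rintro ⟨j, M⟩ h ⟨k, N⟩ h' heq
      obtain ⟨hj, hM⟩ := Finset.mem_sigma.1 h
      obtain ⟨hk, hN⟩ := Finset.mem_sigma.1 h'
      dsimp only at hj hM hk hN heq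
      have hjk : j = k := by
        by_contra hne
        have hmem : s(i, j) ∈ insert s(i, k) N := heq ▸ Finset.mem_insert_self _ _
        rcases Finset.mem_insert.1 hmem with h | h
        · exact hne (Sym2.congr_right.1 h)
        · exact hi (Finset.mem_of_mem_erase
            (((mem_matchings.1 hN).1 _ h).1 i (Sym2.mem_mk_left i j)))
      subst hjk
      have : M = N := by
        rw [← Finset.erase_insert (hnot j M hM), heq, Finset.erase_insert (hnot j N hN)]
      rw [this]
    · intro M hM
      obtain ⟨hM, hcov⟩ := Finset.mem_filter.1 hM
      push Not at hcov
      obtain ⟨e, he, hie⟩ := hcov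
      obtain ⟨j, rfl⟩ := hie
      have hij : i ≠ j := by simpa using ((mem_matchings.1 hM).1 _ he).2
      have hj : j ∈ U := Finset.mem_of_mem_insert_of_ne
        (((mem_matchings.1 hM).1 _ he).1 j (Sym2.mem_mk_right i j)) hij.symm
      exact ⟨⟨j, M.erase s(i, j)⟩, Finset.mem_sigma.2 ⟨hj, erase_mem_matchings hM he⟩,
        Finset.insert_erase he⟩

theorem mu_insert {U : Finset V} {i : V} (hi : i ∉ U) :
    G.mu (insert i U) =
      (X - C (G.r i)) * G.mu U + ∑ j ∈ U, C (G.lam s(i, j)) * G.mu (U.erase j) := by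
  classical
  unfold mu
  rw [sum_matchings_insert hi]
  congr 1
  · rw [Finset.mul_sum]
    refine Finset.sum_congr rfl fun M hM => ?_
    have h := ((mem_matchings_insert_uncovered hi).2 hM).2
    rw [Finset.filter_insert, if_pos h, Finset.prod_insert (by simp [hi]), mul_assoc]
  · refine Finset.sum_congr rfl fun j hj => ?_
    rw [Finset.mul_sum]
    refine Finset.sum_congr rfl fun M hM => ?_
    have hnot : s(i, j) ∉ M := fun h =>
      Finset.notMem_erase j U (((mem_matchings.1 hM).1 _ h).1 j (Sym2.mem_mk_right i j))
    rw [Finset.prod_insert hnot, mul_left_comm]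
    congr 2
    refine Finset.prod_congr (Finset.ext fun v => ?_) fun _ _ => rfl
    simp only [Finset.mem_filter, Finset.mem_insert, Finset.mem_erase, forall_eq_or_imp,
      Sym2.mem_iff, not_or]
    have hv : v = i → v ∉ U := fun h => h ▸ hi
    tauto

theorem mu_monic_and_natDegree (U : Finset V) : (G.mu U).Monic ∧ (G.mu U).natDegree = U.card := by
  induction U using Finset.strongInduction with
  | H U ih =>
    rcases U.eq_empty_or_nonempty with rfl | ⟨i, hiU⟩
    · simp
    · obtain ⟨W, hi, rfl⟩ : ∃ W, i ∉ W ∧ insert i W = U :=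
        ⟨U.erase i, Finset.notMem_erase _ _, Finset.insert_erase hiU⟩
      obtain ⟨hm, hd⟩ := ih W (Finset.ssubset_insert hi)
      have hmon : ((X - C (G.r i)) * G.mu W).Monic := (monic_X_sub_C _).mul hm
      have hdeg : ((X - C (G.r i)) * G.mu W).natDegree = W.card + 1 := by
        rw [(monic_X_sub_C _).natDegree_mul hm, natDegree_X_sub_C, hd, add_comm]
      have hlt : (∑ j ∈ W, C (G.lam s(i, j)) * G.mu (W.erase j)).degree <
          ((X - C (G.r i)) * G.mu W).degree := by
        rw [degree_eq_natDegree hmon.ne_zero, hdeg]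
        refine lt_of_le_of_lt (b := (W.card : WithBot ℕ)) ?_ (by exact_mod_cast Nat.lt_succ_self _)
        refine (degree_sum_le _ _).trans (Finset.sup_le fun j hj => ?_)
        refine degree_le_of_natDegree_le ((natDegree_C_mul_le _ _).trans ?_)
        rw [(ih (W.erase j) ((Finset.erase_ssubset hj).trans (Finset.ssubset_insert hi))).2]
        exact Finset.card_le_card (Finset.erase_subset _ _)
      rw [mu_insert G hi, Finset.card_insert_of_notMem hi]
      exact ⟨hmon.add_of_left hlt, by rw [natDegree_add_eq_left_of_degree_lt hlt, hdeg]⟩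

/-! ### Positivity of the Wronskian along a path -/

/-- The Wronskian of `μ(U)` and `μ(U ∪ {i})` is `μ(U)²` times the derivative of
`μ(U ∪ {i}) / μ(U)`, so this is the derivative of the continued fraction expansion of that ratio. -/
theorem wronskian_mu_insert {U : Finset V} {i : V} (hi : i ∉ U) :
    wronskian (G.mu U) (G.mu (insert i U)) = G.mu U ^ 2 +
      ∑ j ∈ U, C (-G.lam s(i, j)) * wronskian (G.mu (U.erase j)) (G.mu (insert j (U.erase j))) := by
  have h : ∑ j ∈ U, C (-G.lam s(i, j)) *
        wronskian (G.mu (U.erase j)) (G.mu (insert j (U.erase j))) =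
      G.mu U * (∑ j ∈ U, C (G.lam s(i, j)) * derivative (G.mu (U.erase j))) -
      derivative (G.mu U) * ∑ j ∈ U, C (G.lam s(i, j)) * G.mu (U.erase j) := by
    rw [Finset.mul_sum, Finset.mul_sum, ← Finset.sum_sub_distrib]
    refine Finset.sum_congr rfl fun j hj => ?_
    rw [wronskian, Finset.insert_erase hj, C_neg]
    ring
  rw [h, wronskian, mu_insert G hi]
  simp only [derivative_add, derivative_mul, derivative_sum, derivative_sub, derivative_X,
    derivative_C, zero_mul, sub_zero, zero_add]
  ring

theorem wronskian_mu_nonneg (x : ℝ) (U : Finset V) :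
    ∀ i ∉ U, 0 ≤ (wronskian (G.mu U) (G.mu (insert i U))).eval x := by
  induction U using Finset.strongInduction with
  | H U ih =>
    intro i hi
    rw [wronskian_mu_insert G hi, eval_add, eval_pow, eval_finsetSum]
    refine add_nonneg (sq_nonneg _) (Finset.sum_nonneg fun j hj => ?_)
    rw [eval_mul, eval_C]
    exact mul_nonneg (neg_lam_nonneg G hi hj)
      (ih _ (Finset.erase_ssubset hj) j (Finset.notMem_erase _ _))

/-- Along a path the Wronskian does not vanish: the edge from the first to the second vertex
contributes a positive multiple of the Wronskian of the rest of the path. -/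
theorem wronskian_mu_pos_of_isChain (x : ℝ) {i : V} {l : List V}
    (hc : (i :: l).IsChain G.graph.Adj) (hn : (i :: l).Nodup) :
    0 < (wronskian (G.mu l.toFinset) (G.mu (i :: l).toFinset)).eval x := by
  induction l generalizing i with
  | nil =>
    rw [List.toFinset_cons, wronskian_mu_insert G (by simp)]
    simp
  | cons j l ih =>
    have hi : i ∉ (j :: l).toFinset := by simpa using (List.nodup_cons.1 hn).1
    have hn' := (List.nodup_cons.1 hn).2
    have hadj : G.graph.Adj i j := (List.isChain_cons_cons.1 hc).1
    have hj : j ∈ (j :: l).toFinset := by simp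
    have hl : (j :: l).toFinset.erase j = l.toFinset := by
      rw [List.toFinset_cons, Finset.erase_insert (by simpa using (List.nodup_cons.1 hn').1)]
    rw [List.toFinset_cons (a := i), wronskian_mu_insert G hi, eval_add, eval_pow, eval_finsetSum]
    refine add_pos_of_nonneg_of_pos (sq_nonneg _) (Finset.sum_pos' (fun k hk => ?_) ⟨j, hj, ?_⟩)
    · rw [eval_mul, eval_C]
      exact mul_nonneg (neg_lam_nonneg G hi hk)
        (wronskian_mu_nonneg G x _ k (Finset.notMem_erase _ _))
    · rw [eval_mul, eval_C, hl, ← List.toFinset_cons]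
      exact mul_pos (lt_of_le_of_ne (neg_lam_nonneg G hi hj) (neg_ne_zero.2 hadj.2).symm)
        (ih (List.isChain_cons_cons.1 hc).2 hn')

end WeightedGraph

/-! ### Polynomials with positive Wronskian -/

namespace Polynomial
open Filter

theorem eval_wronskian {R : Type*} [CommRing R] (f g : R[X]) (x : R) : (wronskian f g).eval x =
    f.eval x * (derivative g).eval x - (derivative f).eval x * g.eval x := by
  simp [wronskian]

theorem eval_ne_zero_of_wronskian_pos {f g : ℝ[X]} (hw : ∀ x, 0 < (wronskian f g).eval x) {x : ℝ}
    (hg : g.eval x = 0) : f.eval x ≠ 0 := by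
  intro hf
  have := hw x
  simp [eval_wronskian, hf, hg] at this

/-- At a double root of `g` the Wronskian would vanish. -/
theorem nodup_roots_of_wronskian_pos {f g : ℝ[X]} (hw : ∀ x, 0 < (wronskian f g).eval x)
    (hg : g ≠ 0) : g.roots.Nodup := by
  classical
  rw [Multiset.nodup_iff_count_le_one]
  intro x
  rw [count_roots]
  by_contra! h
  obtain ⟨h0, h1⟩ := (one_lt_rootMultiplicity_iff_isRoot hg).1 h
  have := hw x
  rw [eval_wronskian, h0.eq_zero, h1.eq_zero] at this
  simp at this

/-- Since `g / f` is increasing between zeros of `f`, it cannot pass from a nonnegative to a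
nonpositive value without meeting a pole. -/
theorem exists_isRoot_of_wronskian_pos {f g : ℝ[X]} (hw : ∀ x, 0 < (wronskian f g).eval x)
    {u v : ℝ} (huv : u < v) (hfu : f.eval u ≠ 0) (hu : 0 ≤ f.eval u * g.eval u)
    (hfv : f.eval v ≠ 0) (hv : f.eval v * g.eval v ≤ 0) : ∃ z, f.IsRoot z ∧ u < z ∧ z < v := by
  by_contra! hno
  have hf : ∀ z ∈ Set.Icc u v, f.eval z ≠ 0 := by
    intro z hz h0
    rcases eq_or_lt_of_le hz.1 with rfl | h1
    · exact hfu h0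
    rcases eq_or_lt_of_le hz.2 with rfl | h2
    · exact hfv h0
    exact (hno z h0 h1).not_gt h2
  have hmono : StrictMonoOn (fun z => g.eval z / f.eval z) (Set.Icc u v) := by
    refine strictMonoOn_of_deriv_pos (convex_Icc u v)
      (g.continuousOn.div f.continuousOn hf) fun z hz => ?_
    have hz := hf z (interior_subset hz)
    rw [((g.hasDerivAt z).fun_div (f.hasDerivAt z) hz).deriv]
    have := hw z
    rw [eval_wronskian] at this
    exact div_pos (by linarith) (by positivity)
  have hlt := hmono (Set.left_mem_Icc.2 huv.le) (Set.right_mem_Icc.2 huv.le) huv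
  have e : ∀ z, g.eval z / f.eval z = f.eval z * g.eval z / f.eval z ^ 2 := by
    intro z
    by_cases h : f.eval z = 0
    · simp [h]
    · field_simp
  simp only [e] at hlt
  exact absurd (hlt.trans_le (div_nonpos_of_nonpos_of_nonneg hv (sq_nonneg _)))
    (div_nonneg hu (sq_nonneg _)).not_gt

/-- The distinct real roots of `p` that are less than `t`. -/
noncomputable def rootsBelow (p : ℝ[X]) (t : ℝ) : Finset ℝ :=
  {x ∈ p.roots.toFinset | x < t}

theorem mem_rootsBelow {p : ℝ[X]} (hp : p ≠ 0) {t x : ℝ} :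
    x ∈ p.rootsBelow t ↔ p.eval x = 0 ∧ x < t := by
  simp [rootsBelow, hp]

/-- The points of `s` may be roots of `g`, or a least point at which `g / f` is nonnegative, or a
greatest point at which `g / f` is nonpositive. -/
theorem card_le_card_rootsBelow_add_one {f g : ℝ[X]} (hw : ∀ x, 0 < (wronskian f g).eval x)
    (hf : f ≠ 0) {t : ℝ} {s : Finset ℝ} (hst : ∀ x ∈ s, x ≤ t)
    (hs : ∀ x ∈ s, ∀ y ∈ s, x < y → (f.eval x ≠ 0 ∧ 0 ≤ f.eval x * g.eval x) ∧
      f.eval y ≠ 0 ∧ f.eval y * g.eval y ≤ 0) :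
    s.card ≤ (f.rootsBelow t).card + 1 := by
  refine Finset.card_le_of_interleaved fun x hx y hy hxy _ => ?_
  obtain ⟨⟨h1, h2⟩, h3, h4⟩ := hs x hx y hy hxy
  obtain ⟨z, hz, hxz, hzy⟩ := exists_isRoot_of_wronskian_pos hw hxy h1 h2 h3 h4
  exact ⟨z, (mem_rootsBelow hf).2 ⟨hz, hzy.trans_le (hst y hy)⟩, hxz, hzy⟩

/-- If `f` and `g` are monic and `g` has one degree more than `f`, then `g / f` tends to `-∞`
at `-∞`. -/
theorem eventually_atBot_mul_neg {f g : ℝ[X]} (hf : f.Monic) (hg : g.Monic)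
    (hd : g.natDegree = f.natDegree + 1) : ∀ᶠ x in atBot, f.eval x * g.eval x < 0 := by
  have hfg : (f * g).Monic := hf.mul hg
  have hdeg : (f * g).natDegree = 2 * f.natDegree + 1 := by
    rw [hf.natDegree_mul hg, hd]; ring
  have hcomp : ((f * g).comp (-X)).natDegree = 2 * f.natDegree + 1 := by
    rw [natDegree_comp, natDegree_neg, natDegree_X, mul_one, hdeg]
  have ht : Tendsto (fun x => ((f * g).comp (-X)).eval x) atTop atBot := by
    refine tendsto_atBot_of_leadingCoeff_nonpos _ ?_ ?_
    · exact natDegree_pos_iff_degree_pos.1 (by omega)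
    · rw [leadingCoeff_comp (by simp), hfg.leadingCoeff, hdeg]
      simp [Odd.neg_one_pow ⟨_, rfl⟩]
  have h := (ht.comp tendsto_neg_atBot_atTop).eventually (eventually_lt_atBot 0)
  filter_upwards [h] with x hx
  simpa using hx

theorem eventually_atTop_mul_pos {f g : ℝ[X]} (hf : f.Monic) (hg : g.Monic)
    (hd : g.natDegree = f.natDegree + 1) : ∀ᶠ x in atTop, 0 < f.eval x * g.eval x := by
  have ht : Tendsto (fun x => (f * g).eval x) atTop atTop := by
    refine tendsto_atTop_of_leadingCoeff_nonneg _ ?_ ?_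
    · refine natDegree_pos_iff_degree_pos.1 ?_
      rw [hf.natDegree_mul hg, hd]
      omega
    · rw [(hf.mul hg).leadingCoeff]
      exact zero_le_one
  filter_upwards [ht.eventually (eventually_gt_atTop 0)] with x hx
  simpa using hx

/-- As the increasing function `g / f` comes from `-∞` at `-∞`, its zeros and poles alternate,
beginning with a zero; hence its sign at `t` tells whether the last of them before `t` is a zero. -/
theorem card_rootsBelow_eq {f g : ℝ[X]} (hw : ∀ x, 0 < (wronskian f g).eval x)
    (hf : f.Monic) (hg : g.Monic) (hd : g.natDegree = f.natDegree + 1) {t : ℝ}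
    (ht : f.eval t ≠ 0) :
    (g.rootsBelow t).card =
      (f.rootsBelow t).card + if 0 < f.eval t * g.eval t then 1 else 0 := by
  have hw' : ∀ x, 0 < (wronskian g (-f)).eval x := by
    intro x
    rw [wronskian_neg_right, wronskian_neg_eq]
    exact hw x
  have hfr : ∀ x, f.eval x = 0 → g.eval x ≠ 0 := fun x hx =>
    eval_ne_zero_of_wronskian_pos hw' (by simpa using hx)
  have hgr : ∀ x, g.eval x = 0 → f.eval x ≠ 0 := fun x => eval_ne_zero_of_wronskian_pos hw
  -- A point to the left of `t` and of all roots of `f` stands in for `-∞`.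
  obtain ⟨b, hb, hbt, hbf⟩ : ∃ b, f.eval b * g.eval b < 0 ∧ b < t ∧ ∀ x ∈ f.rootsBelow t, b < x :=
    ((eventually_atBot_mul_neg hf hg hd).and ((eventually_lt_atBot t).and
      ((f.rootsBelow t).eventually_all.2 fun x _ => eventually_lt_atBot x))).exists
  have hgb : g.eval b ≠ 0 := fun h => by simp [h] at hb
  have hbnot : b ∉ f.rootsBelow t := fun h => lt_irrefl _ (hbf b h)
  have htf : t ∉ f.rootsBelow t := fun h => lt_irrefl _ ((mem_rootsBelow hf.ne_zero).1 h).2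
  have htg : t ∉ g.rootsBelow t := fun h => lt_irrefl _ ((mem_rootsBelow hg.ne_zero).1 h).2
  -- In all four inequalities the listed points are separated by roots of the other polynomial. The
  -- roles of `f` and `g` are exchanged by `wronskian g (-f) = wronskian f g`. Among the points are
  -- `b` when the others are roots of `f`, and `t` when the sign of `g / f` at `t` allows it.
  split_ifs with hpos
  · have hgt : g.eval t ≠ 0 := fun h => by simp [h] at hpos
    refine le_antisymm ?_ ?_
    · refine card_le_card_rootsBelow_add_one hw hf.ne_zero
        (fun x hx => ((mem_rootsBelow hg.ne_zero).1 hx).2.le) fun x hx y hy _ => ?_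
      have hx := ((mem_rootsBelow hg.ne_zero).1 hx).1
      have hy := ((mem_rootsBelow hg.ne_zero).1 hy).1
      exact ⟨⟨hgr x hx, by simp [hx]⟩, hgr y hy, by simp [hy]⟩
    · have h := card_le_card_rootsBelow_add_one (t := t) (s := insert t (insert b (f.rootsBelow t)))
        hw' hg.ne_zero ?_ ?_
      · rw [Finset.card_insert_of_notMem, Finset.card_insert_of_notMem hbnot] at h
        · omega
        · simp [hbt.ne', htf]
      · simp only [Finset.mem_insert, mem_rootsBelow hf.ne_zero]
        rintro x (rfl | rfl | hx)
        exacts [le_rfl, hbt.le, hx.2.le]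
      · simp only [Finset.mem_insert]
        intro x hx y hy hxy
        constructor
        · rcases hx with rfl | rfl | hx
          · rcases hy with rfl | rfl | hy
            · exact absurd hxy (lt_irrefl _)
            · exact absurd hxy hbt.not_gt
            · exact absurd hxy ((mem_rootsBelow hf.ne_zero).1 hy).2.not_gt
          · exact ⟨hgb, by rw [eval_neg]; linarith⟩
          · have hx := ((mem_rootsBelow hf.ne_zero).1 hx).1
            exact ⟨hfr x hx, by simp [hx]⟩
        · rcases hy with rfl | rfl | hy
          · exact ⟨hgt, by rw [eval_neg]; linarith⟩
          · rcases hx with rfl | rfl | hx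
            · exact absurd hxy hbt.not_gt
            · exact absurd hxy (lt_irrefl _)
            · exact absurd hxy (hbf x hx).not_gt
          · have hy := ((mem_rootsBelow hf.ne_zero).1 hy).1
            exact ⟨hfr y hy, by simp [hy]⟩
  · rw [add_zero]
    refine le_antisymm ?_ ?_
    · have h := card_le_card_rootsBelow_add_one (t := t) (s := insert t (g.rootsBelow t))
        hw hf.ne_zero ?_ ?_
      · rw [Finset.card_insert_of_notMem htg] at h
        omega
      · simp only [Finset.mem_insert, mem_rootsBelow hg.ne_zero]
        rintro x (rfl | hx)
        exacts [le_rfl, hx.2.le]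
      · simp only [Finset.mem_insert, mem_rootsBelow hg.ne_zero]
        intro x hx y hy hxy
        constructor
        · rcases hx with rfl | hx
          · rcases hy with rfl | hy
            · exact absurd hxy (lt_irrefl _)
            · exact absurd hxy hy.2.not_gt
          · exact ⟨hgr x hx.1, by simp [hx.1]⟩
        · rcases hy with rfl | hy
          · exact ⟨ht, not_lt.1 hpos⟩
          · exact ⟨hgr y hy.1, by simp [hy.1]⟩
    · have h := card_le_card_rootsBelow_add_one (t := t) (s := insert b (f.rootsBelow t))
        hw' hg.ne_zero ?_ ?_
      · rw [Finset.card_insert_of_notMem hbnot] at h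
        omega
      · simp only [Finset.mem_insert, mem_rootsBelow hf.ne_zero]
        rintro x (rfl | hx)
        exacts [hbt.le, hx.2.le]
      · simp only [Finset.mem_insert]
        intro x hx y hy hxy
        constructor
        · rcases hx with rfl | hx
          · exact ⟨hgb, by rw [eval_neg]; linarith⟩
          · have hx := ((mem_rootsBelow hf.ne_zero).1 hx).1
            exact ⟨hfr x hx, by simp [hx]⟩
        · rcases hy with rfl | hy
          · rcases hx with rfl | hx
            · exact absurd hxy (lt_irrefl _)
            · exact absurd hxy (hbf x hx).not_gt
          · have hy := ((mem_rootsBelow hf.ne_zero).1 hy).1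
            exact ⟨hfr y hy, by simp [hy]⟩

/-- Counting to the left of a point beyond all roots of `f` shows that `g` has one root more
than `f`. -/
theorem splits_of_wronskian_pos {f g : ℝ[X]} (hw : ∀ x, 0 < (wronskian f g).eval x)
    (hf : f.Monic) (hg : g.Monic) (hd : g.natDegree = f.natDegree + 1)
    (hs : f.Splits) (hn : f.roots.Nodup) : g.Splits := by
  obtain ⟨t, htpos, htf⟩ : ∃ t, 0 < f.eval t * g.eval t ∧ ∀ x ∈ f.roots.toFinset, x < t :=
    ((eventually_atTop_mul_pos hf hg hd).and
      (f.roots.toFinset.eventually_all.2 fun x _ => eventually_gt_atTop x)).exists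
  have h := card_rootsBelow_eq hw hf hg hd (t := t) fun h => by simp [h] at htpos
  rw [if_pos htpos, rootsBelow, rootsBelow, Finset.filter_true_of_mem htf,
    Multiset.toFinset_card_of_nodup hn, splits_iff_card_roots.1 hs, ← hd] at h
  refine splits_iff_card_roots.2 (le_antisymm (card_roots' g) ?_)
  rw [← h]
  exact (Finset.card_filter_le _ _).trans (Multiset.toFinset_card_le _)

end Polynomial

/-- The value of the rational function `g / f` at a point that is not a pole of it is the quotient
of the values, because `f` and `g` have no common root. -/
theorem RatFunc.eval_div_of_wronskian_pos {f g : ℝ[X]}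
    (hw : ∀ x, 0 < (wronskian f g).eval x) (hf : f ≠ 0) {t : ℝ}
    (ht : (algebraMap ℝ[X] (RatFunc ℝ) g / algebraMap ℝ[X] (RatFunc ℝ) f).denom.eval t ≠ 0) :
    f.eval t ≠ 0 ∧
      (algebraMap ℝ[X] (RatFunc ℝ) g / algebraMap ℝ[X] (RatFunc ℝ) f).eval (RingHom.id ℝ) t =
        g.eval t / f.eval t := by
  have h := congrArg (Polynomial.eval t) ((RatFunc.num_mul_eq_mul_denom_iff (p := g) hf).2 rfl)
  rw [Polynomial.eval_mul, Polynomial.eval_mul] at h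
  have hft : f.eval t ≠ 0 := by
    intro h0
    rw [h0, mul_zero] at h
    exact eval_ne_zero_of_wronskian_pos hw ((mul_eq_zero.1 h.symm).resolve_right ht) h0
  refine ⟨hft, ?_⟩
  rw [RatFunc.eval, eval₂_id, eval₂_id, div_eq_div_iff ht hft, h]

/-! ### Sylvester's theorem along a list of vertices -/

namespace WeightedGraph

variable {V : Type*} [DecidableEq V] (G : WeightedGraph V)

theorem mu_splits_and_nodup_roots {l : List V} (hc : l.IsChain G.graph.Adj) (hn : l.Nodup) :
    (G.mu l.toFinset).Splits ∧ (G.mu l.toFinset).roots.Nodup := by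
  induction l with
  | nil => simp
  | cons i l ih =>
    obtain ⟨hs, hr⟩ := ih hc.tail (List.nodup_cons.1 hn).2
    have hw := fun x => G.wronskian_mu_pos_of_isChain x hc hn
    obtain ⟨hf, hfd⟩ := G.mu_monic_and_natDegree l.toFinset
    obtain ⟨hg, hgd⟩ := G.mu_monic_and_natDegree (i :: l).toFinset
    refine ⟨splits_of_wronskian_pos hw hf hg ?_ hs hr, nodup_roots_of_wronskian_pos hw hg.ne_zero⟩
    rw [hfd, hgd, List.toFinset_cons,
      Finset.card_insert_of_notMem (by simpa using (List.nodup_cons.1 hn).1)]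

/-- The number of roots below `t` drops by one at each index with a positive ratio and is unchanged
at the others, down to the constant polynomial `μ(∅) = 1`. -/
theorem numPos_eq_card_rootsBelow [Fintype V] {l : List V} (hc : l.IsChain G.graph.Adj)
    (hn : l.Nodup) (hl : ∀ v, v ∈ l) {t : ℝ} (ht : G.FiniteAlong l t) :
    G.numPos l t = ((G.mu Finset.univ).rootsBelow t).card := by
  classical
  have hdrop : ∀ k, Finset.univ \ (l.take k).toFinset = (l.drop k).toFinset := by
    intro k
    ext v
    have hv := hl v
    rw [← List.take_append_drop k l] at hv hn
    have hdisj := List.disjoint_of_nodup_append hn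
    simp only [Finset.mem_sdiff, Finset.mem_univ, true_and, List.mem_toFinset]
    exact ⟨(List.mem_append.1 hv).resolve_left, fun h h' => hdisj h' h⟩
  have hstep : ∀ k < l.length, ((G.mu (l.drop k).toFinset).rootsBelow t).card =
      ((G.mu (l.drop (k + 1)).toFinset).rootsBelow t).card +
        if 0 < (G.ratio l k).eval (RingHom.id ℝ) t then 1 else 0 := by
    intro k hk
    have hcons := List.drop_eq_getElem_cons hk
    have hc' : (l.drop k).IsChain G.graph.Adj := hc.drop k
    have hn' : (l.drop k).Nodup := hn.sublist (List.drop_sublist k l)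
    rw [hcons] at hc' hn'
    have hw := fun x => G.wronskian_mu_pos_of_isChain x hc' hn'
    have hk' := ht k hk
    obtain ⟨hf, hfd⟩ := G.mu_monic_and_natDegree (l.drop (k + 1)).toFinset
    obtain ⟨hg, hgd⟩ := G.mu_monic_and_natDegree (l[k] :: l.drop (k + 1)).toFinset
    rw [ratio, hdrop, hdrop, hcons] at hk'
    rw [ratio, hdrop, hdrop, hcons]
    obtain ⟨h0, he⟩ := RatFunc.eval_div_of_wronskian_pos hw hf.ne_zero hk'
    rw [card_rootsBelow_eq hw hf hg ?_ h0, he]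
    · congr 2
      rw [eq_iff_iff, mul_comm, mul_pos_iff, div_pos_iff]
    · rw [hfd, hgd, List.toFinset_cons,
        Finset.card_insert_of_notMem (by simpa using (List.nodup_cons.1 hn').1)]
  have hsum : ∀ m ≤ l.length, ((G.mu (l.drop 0).toFinset).rootsBelow t).card =
      ((G.mu (l.drop m).toFinset).rootsBelow t).card +
        ∑ k ∈ Finset.range m, if 0 < (G.ratio l k).eval (RingHom.id ℝ) t then 1 else 0 := by
    intro m
    induction m with
    | zero => simp
    | succ m ih =>
      intro hm
      rw [ih (by omega), hstep m (by omega), Finset.sum_range_succ]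
      ring
  have h := hsum l.length le_rfl
  rw [List.drop_length, List.drop_zero, List.toFinset_nil, mu_empty] at h
  have huniv : l.toFinset = Finset.univ := by ext v; simp [hl]
  rw [huniv] at h
  rw [h, numPos, Finset.card_filter]
  simp [rootsBelow]

end WeightedGraph

theorem mainTheorem2 {V : Type*} [Fintype V] [DecidableEq V] (G : WeightedGraph V) {a b : V}
    (c : G.graph.Walk a b) (hc : c.IsHamiltonian) :
    (∀ θ : ℝ, G.FiniteAlong c.support θ →
      G.numPos c.support θ = {x : ℝ | (G.mu Finset.univ).IsRoot x ∧ x < θ}.ncard) ∧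
    (∀ θ : ℝ, G.FiniteAlong c.reverse.support θ →
      G.numPos c.reverse.support θ = {x : ℝ | (G.mu Finset.univ).IsRoot x ∧ x < θ}.ncard) ∧
    ((G.mu Finset.univ).Splits ∧ (G.mu Finset.univ).roots.Nodup) := by
  have hset : ∀ θ : ℝ, ((G.mu Finset.univ).rootsBelow θ).card =
      {x : ℝ | (G.mu Finset.univ).IsRoot x ∧ x < θ}.ncard := by
    intro θ
    rw [← Set.ncard_coe_finset]
    congr 1
    ext x
    exact Polynomial.mem_rootsBelow (G.mu_monic_and_natDegree _).1.ne_zero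
  have hn := hc.isPath.support_nodup
  refine ⟨fun θ h => ?_, fun θ h => ?_, ?_⟩
  · rw [← hset, WeightedGraph.numPos_eq_card_rootsBelow G c.isChain_adj_support hn hc.mem_support h]
  · rw [← hset, WeightedGraph.numPos_eq_card_rootsBelow G c.reverse.isChain_adj_support ?_ ?_ h]
    · rw [c.support_reverse]
      exact List.nodup_reverse.2 hn
    · intro v
      rw [c.support_reverse, List.mem_reverse]
      exact hc.mem_support v
  · rw [← hc.toFinset_support]
    exact WeightedGraph.mu_splits_and_nodup_roots G c.isChain_adj_support hn
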